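/- **Theorem 6 (second-moment coverage of the hierarchical jackknife+).** *Model.* Let $\mathcal X$ be a measurable space and $\mathcal Y\subseteq\mathbb R$; let $P_X$ be a probability distribution on $\mathcal X$, $P_{N|X}$ a conditional distribution on $\{1,2,\dots\}$ given $X$, and $P_{Y|X}$ a conditional distribution on $\mathcal Y$ given $X$. Let $K\ge 1$. Independently for $k=1,\dots,K$, draw $$X_k\sim P_X,\qquad N_k\mid X_k\sim P_{N|X},\qquad Y_{k,1},\dots,Y_{k,N_k}\mid (X_k,N_k)\overset{\text{iid}}{\sim}P_{Y|X},$$ and put $X_{k,i}=X_k$, $Z_{k,i}=(X_{k,i},Y_{k,i})$, $\tilde Z_k=(Z_{k,1},\dots,Z_{k,N_k})$, $\mathcal D=(\tilde Z_1,\dots,\tilde Z_K)$. Assume $\mathbb P(N\ge 2)>0$ when $X\sim P_X$, $N\mid X\sim P_{N|X}$, and let $P_X^{\ge 2}$ be the conditional distribution of $X$ given $N\ge 2$ under this joint model. *Method.* Let $\mathcal Z=\mathcal X\times\mathcal Y$ and let $\tilde{\mathcal Z}=\mathcal Z\cup\mathcal Z^2\cup\cdots$ be the set of nonempty finite sequences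 in $\mathcal Z$. Let $\mathcal A$ be a (jointly measurable) algorithm mapping $\tilde{\mathcal Z}^{K-1}$ to functions $\mathcal X\to\mathbb R$ that is hierarchically symmetric: its output is unchanged when its $K-1$ input groups are permuted, and when the data points within any one input group are permuted. Define $$\widehat\mu_{-k}=\mathcal A(\tilde Z_1,\dots,\tilde Z_{k-1},\tilde Z_{k+1},\dots,\tilde Z_K),\qquad R_{k,i}=|Y_{k,i}-\widehat\mu_{-k}(X_{k,i})|,$$ and $K^{\ge 2}=\#\{k\le K: N_k\ge 2\}$. For a distribution $P$ on $[-\infty,\infty]$ let $Q_\beta(P)=\inf\{t\in\mathbb R: P([-\infty,t])\ge\beta\}$ and $Q'_\beta(P)=\sup\{t\in\mathbb R:P([-\infty,t])\le\beta\}$, with $\inf\emptyset=+\infty$ and $\sup\emptyset=-\infty$. For $\alpha\in\mathbb R$ (in particular for every level $\alpha\in(0,1)$) let $\widehat C(x)$ be the set of real $y$ with $$Q'_{\alpha^2}\Bigl(\sum_{k:\,N_k\ge 2}\ \sum_{1\le i<i'\le N_k}\tfrac{1}{(K^{\ge 2}+1)\binom{N_k}{2}}\,\delta_{\widehat\mu_{-k}(x)-\min\{R_{k,i},R_{k,i'}\}}+\tfrac{1}{K^{\ge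 2}+1}\,\delta_{-\infty}\Bigr)\ \le\ y$$ and $$y\ \le\ Q_{1-\alpha^2}\Bigl(\sum_{k:\,N_k\ge 2}\ \sum_{1\le i<i'\le N_k}\tfrac{1}{(K^{\ge 2}+1)\binom{N_k}{2}}\,\delta_{\widehat\mu_{-k}(x)+\min\{R_{k,i},R_{k,i'}\}}+\tfrac{1}{K^{\ge 2}+1}\,\delta_{+\infty}\Bigr).$$ *Conclusion.* Let $\alpha_{\mathcal D}(x)=P_{Y|X=x}\bigl(\{y: y\notin\widehat C(x)\}\bigr)$ be the miscoverage rate conditional on the data $\mathcal D$ and on the test feature $X_{\mathrm{test}}=x$. Then, with $X_{\mathrm{test}}\sim P_X^{\ge 2}$ drawn independently of $\mathcal D$, the variable $\alpha_{\mathcal D}(X_{\mathrm{test}})^2$ is integrable and $$\mathbb E_{P_X^{\ge 2}}\bigl[\alpha_{\mathcal D}(X_{\mathrm{test}})^2\bigr]\le 4\alpha^2,$$ the expectation being over both $\mathcal D$ and $X_{\mathrm{test}}$. -/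

import Mathlib

open MeasureTheory ProbabilityTheory

open scoped ENNReal

noncomputable section

namespace HierJackknife

/-- The possible numbers of measurements in a group: `1, 2, 3, …`. -/
abbrev GroupSize : Type := {n : ℕ // 1 ≤ n}

/-- Nonempty finite sequences `(z₁, …, z_n)` of data points `zᵢ = (xᵢ, yᵢ)`, with responses in
`𝒴 ⊆ ℝ`. -/
abbrev Group (𝒳 : Type*) (𝒴 : Set ℝ) : Type _ := (n : GroupSize) × (Fin n.1 → 𝒳 × 𝒴)

section Model

variable {𝒳 : Type*} [MeasurableSpace 𝒳] {𝒴 : Set ℝ}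

/-- The group with common feature `x` and responses `y₁, …, y_n`. -/
def mkGroup (x : 𝒳) (n : GroupSize) (y : Fin n.1 → 𝒴) : Group 𝒳 𝒴 := ⟨n, fun i => (x, y i)⟩

/-- The law of the group given `(X, N) = (x, n)`: the feature is `x` throughout, and the `n`
responses are i.i.d. from `P_{Y|X=x}`. -/
def groupLawGiven (PY : Kernel 𝒳 𝒴) (p : 𝒳 × GroupSize) : Measure (Group 𝒳 𝒴) :=
  (Measure.pi fun _ : Fin p.2.1 => PY p.1).map (mkGroup p.1 p.2)

/-- The law of one group in the repeated-measurements model: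
`X ∼ P_X`, `N ∣ X ∼ P_{N|X}`, and `Y₁, …, Y_N ∣ (X, N)` i.i.d. from `P_{Y|X}`. -/
def groupLaw (PX : Measure 𝒳) (PN : Kernel 𝒳 GroupSize) (PY : Kernel 𝒳 𝒴) :
    Measure (Group 𝒳 𝒴) :=
  (PX ⊗ₘ PN).bind (groupLawGiven PY)

/-- The event `N ≥ 2` for a pair `(X, N)`. -/
def atLeastTwo (𝒳 : Type*) : Set (𝒳 × GroupSize) := {p | 2 ≤ p.2.1}

/-- `P_X^{≥2}`: the conditional law of `X` given `N ≥ 2`, when `X ∼ P_X` and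
`N ∣ X ∼ P_{N|X}`. -/
def featureLawGeTwo (PX : Measure 𝒳) (PN : Kernel 𝒳 GroupSize) : Measure 𝒳 :=
  (ProbabilityTheory.cond (PX ⊗ₘ PN) (atLeastTwo 𝒳)).map Prod.fst

lemma measurable_mkGroup (n : GroupSize) :
    Measurable fun q : 𝒳 × (Fin n.1 → 𝒴) => mkGroup q.1 n q.2 := by
  have h : Measurable fun z : Fin n.1 → 𝒳 × 𝒴 => (⟨n, z⟩ : Group 𝒳 𝒴) :=
    fun s hs => (MeasurableSpace.measurableSet_iInf.1 hs) n
  refine h.comp ?_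
  fun_prop

lemma measurable_groupLawGiven (PY : Kernel 𝒳 𝒴) [IsMarkovKernel PY] :
    Measurable (groupLawGiven PY) := by
  refine measurable_from_prod_countable_left fun n => ?_
  have hpi : Measurable fun x : 𝒳 => Measure.pi fun _ : Fin n.1 => PY x := by
    refine Measurable.measure_of_isPiSystem_of_isProbabilityMeasure
      generateFrom_pi.symm isPiSystem_pi ?_
    rintro _ ⟨s, hs, rfl⟩
    simp only [Measure.pi_pi]
    exact Finset.measurable_prod _ fun i _ => PY.measurable_coe (hs i (Set.mem_univ i))
  refine Measure.measurable_of_measurable_coe _ fun s hs => ?_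
  have hm : ∀ x : 𝒳, Measurable (mkGroup (𝒴 := 𝒴) x n) := fun x =>
    (measurable_mkGroup n).comp measurable_prodMk_left
  let κ : Kernel 𝒳 (Fin n.1 → 𝒴) := ⟨_, hpi⟩
  have : IsMarkovKernel κ := ⟨fun x => by
    change IsProbabilityMeasure (Measure.pi fun _ : Fin n.1 => PY x); infer_instance⟩
  have h := Kernel.measurable_kernel_prodMk_left (κ := κ) (measurable_mkGroup n hs)
  convert h using 2 with x
  exact Measure.map_apply (hm x) hs

/-- The hierarchical sampling scheme defines a probability distribution. -/
instance isProbabilityMeasure_groupLaw (PX : Measure 𝒳) [IsProbabilityMeasure PX]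
    (PN : Kernel 𝒳 GroupSize) [IsMarkovKernel PN] (PY : Kernel 𝒳 𝒴) [IsMarkovKernel PY] :
    IsProbabilityMeasure (groupLaw PX PN PY) := by
  constructor
  rw [groupLaw, Measure.bind_apply MeasurableSet.univ (measurable_groupLawGiven PY).aemeasurable]
  have h : ∀ p : 𝒳 × GroupSize, groupLawGiven PY p Set.univ = 1 := fun p => by
    have hm : Measurable (mkGroup (𝒴 := 𝒴) p.1 p.2) :=
      (measurable_mkGroup p.2).comp measurable_prodMk_left
    rw [groupLawGiven, Measure.map_apply hm MeasurableSet.univ]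
    simp
  simp [h]

end Model

section Quantiles

/-- `Q_β(P) = inf {t ∈ ℝ : P((-∞, t]) ≥ β}`, for a distribution `P` on the extended reals;
an infimum over the empty set is `+∞`. -/
def quantile (β : ℝ) (P : Measure EReal) : EReal :=
  sInf ((fun t : ℝ => (t : EReal)) '' {t : ℝ | β ≤ P.real (Set.Iic (t : EReal))})

/-- `Q'_β(P) = sup {t ∈ ℝ : P([-∞, t]) ≤ β}`, for a distribution `P` on the extended reals;
a supremum over the empty set is `-∞`. -/
def quantile' (β : ℝ) (P : Measure EReal) : EReal :=
  sSup ((fun t : ℝ => (t : EReal)) '' {t : ℝ | P.real (Set.Iic (t : EReal)) ≤ β})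

end Quantiles

section Method

variable {𝒳 : Type*} {𝒴 : Set ℝ} {m : ℕ}

/-- A regression algorithm, fed with `m` groups and returning a function `𝒳 → ℝ`, is
hierarchically symmetric if its output is unchanged when the groups are permuted and when the
data points inside any one group are permuted. -/
def HierSymmetric (A : (Fin m → Group 𝒳 𝒴) → 𝒳 → ℝ) : Prop :=
  (∀ (z : Fin m → Group 𝒳 𝒴) (σ : Equiv.Perm (Fin m)), A (fun k => z (σ k)) = A z) ∧
  ∀ (z : Fin m → Group 𝒳 𝒴) (k : Fin m) (σ : Equiv.Perm (Fin (z k).1.1)),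
    A (Function.update z k ⟨(z k).1, fun i => (z k).2 (σ i)⟩) = A z

/-- The leave-one-group-out model `μ̂_{-k}` for the data set `d` of `K = m + 1` groups. -/
def looModel (A : (Fin m → Group 𝒳 𝒴) → 𝒳 → ℝ) (d : Fin (m + 1) → Group 𝒳 𝒴)
    (k : Fin (m + 1)) : 𝒳 → ℝ :=
  A fun j => d (k.succAbove j)

/-- The residual `R_{k,i} = |Y_{k,i} - μ̂_{-k}(X_{k,i})|`. -/
def residual (A : (Fin m → Group 𝒳 𝒴) → 𝒳 → ℝ) (d : Fin (m + 1) → Group 𝒳 𝒴)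
    (k : Fin (m + 1)) (i : Fin (d k).1.1) : ℝ :=
  |(((d k).2 i).2 : ℝ) - looModel A d k ((d k).2 i).1|

/-- The indices `k` of the groups with `N_k ≥ 2`. -/
def bigGroups (d : Fin (m + 1) → Group 𝒳 𝒴) : Finset (Fin (m + 1)) :=
  Finset.univ.filter fun k => 2 ≤ (d k).1.1

/-- The pairs `i < i'` of indices in a group of size `n`. -/
def indexPairs (n : ℕ) : Finset (Fin n × Fin n) :=
  Finset.univ.filter fun p => p.1 < p.2

/-- The distribution
`∑_{k : N_k ≥ 2} ∑_{i < i'} 1 / ((K^{≥2} + 1) (N_k choose 2)) δ_{v(k,i,i')} + 1 / (K^{≥2} + 1) δ_e`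
on the extended reals, where `K^{≥2}` is the number of `k` with `N_k ≥ 2`. -/
def pairDistribution (d : Fin (m + 1) → Group 𝒳 𝒴)
    (v : (k : Fin (m + 1)) → Fin (d k).1.1 → Fin (d k).1.1 → ℝ) (e : EReal) : Measure EReal :=
  (∑ k ∈ bigGroups d, ∑ p ∈ indexPairs (d k).1.1,
    ((((bigGroups d).card : ℝ≥0∞) + 1) * ((d k).1.1.choose 2 : ℝ≥0∞))⁻¹ •
      Measure.dirac (v k p.1 p.2 : EReal)) +
  (((bigGroups d).card : ℝ≥0∞) + 1)⁻¹ • Measure.dirac e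

/-- The lower endpoint of the prediction interval at `x`. -/
def lowerEnd (α : ℝ) (A : (Fin m → Group 𝒳 𝒴) → 𝒳 → ℝ) (d : Fin (m + 1) → Group 𝒳 𝒴)
    (x : 𝒳) : EReal :=
  quantile' (α ^ 2) (pairDistribution d
    (fun k i i' => looModel A d k x - min (residual A d k i) (residual A d k i')) ⊥)

/-- The upper endpoint of the prediction interval at `x`. -/
def upperEnd (α : ℝ) (A : (Fin m → Group 𝒳 𝒴) → 𝒳 → ℝ) (d : Fin (m + 1) → Group 𝒳 𝒴)
    (x : 𝒳) : EReal :=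
  quantile (1 - α ^ 2) (pairDistribution d
    (fun k i i' => looModel A d k x + min (residual A d k i) (residual A d k i')) ⊤)

/-- The prediction interval `Ĉ(x)`. -/
def predictionInterval (α : ℝ) (A : (Fin m → Group 𝒳 𝒴) → 𝒳 → ℝ)
    (d : Fin (m + 1) → Group 𝒳 𝒴) (x : 𝒳) : Set ℝ :=
  {y : ℝ | lowerEnd α A d x ≤ (y : EReal) ∧ (y : EReal) ≤ upperEnd α A d x}

/-- The conditional miscoverage rate `α_𝒟(x)`: the probability that a response drawn from
`P_{Y|X=x}` falls outside `Ĉ(x)`, the data set `d` being fixed. -/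
def miscoverage [MeasurableSpace 𝒳] (PY : Kernel 𝒳 𝒴) (α : ℝ)
    (A : (Fin m → Group 𝒳 𝒴) → 𝒳 → ℝ) (d : Fin (m + 1) → Group 𝒳 𝒴) (x : 𝒳) : ℝ :=
  (PY x).real {y : 𝒴 | (y : ℝ) ∉ predictionInterval α A d x}

end Method

end HierJackknife

end

/-! Adjoin the test group to the `m + 1` training groups and let each of the `m + 2` i.i.d. groups
play the test role in turn. Two responses of a group with `N ≥ 2` are conditionally independent
given `(X, N)`, so the squared miscoverage at `X` is the conditional probability that a given pair
of the group is entirely uncovered. It is therefore enough to bound the expected proportion of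
uncovered pairs in a random test group and divide by the probability that `N ≥ 2`.

That bound is deterministic after summing over the test role (`sum_jointlyUncovered_le`). Let `n` be
the number of groups of size at least two among all `m + 2`. If a point of such a group is
uncovered, the quantile definition leaves weight at most `α² n - 1` for training pairs whose smaller
residual is at least the residual of that point (`Uncovered.sum_pairMean_le`). Compare pairs from
two groups by their smaller residuals under the model trained without both groups; this model does
not depend on the order of removal, so the comparison is a tournament. A pair with both points
uncovered is below or tied with pairs of total weight at most `2 (α² n - 1)`, by a union bound over
its two points. Summing over all such pairs counts every comparison between groups at least once,
while comparisons inside a group cost at most the total weight `M` of the uncovered pairs, whence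
`M² ≤ 4 (α² n - 1) M + M` and `M ≤ 4 α² n`. -/

noncomputable section

namespace HierJackknife

/-! ### Weighted tournaments. -/

section Tournament

/-- Weighted tournament bound: if items in different groups are always comparable, every group has
total weight at most one, and every item of `S` beats or ties items of other groups in `S` of total
weight at most `C`, then the total weight of `S` is at most any `B ≥ max 0 (2 * C + 1)`. -/
theorem tournament_weight_le {ι κ : Type*} [DecidableEq κ] (S : Finset ι) (g : ι → κ) (w : ι → ℝ)
    (hw : ∀ a, 0 ≤ w a) (r : ι → ι → Prop) [DecidableRel r]
    (hr : ∀ a ∈ S, ∀ b ∈ S, g b ≠ g a → r a b ∨ r b a)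
    (hg : ∀ a ∈ S, ∑ b ∈ S with g b = g a, w b ≤ 1) {C B : ℝ}
    (hC : ∀ a ∈ S, ∑ b ∈ S, (if g b ≠ g a ∧ r a b then w b else 0) ≤ C)
    (hB : 0 ≤ B) (hCB : 2 * C + 1 ≤ B) :
    ∑ a ∈ S, w a ≤ B := by
  set M := ∑ a ∈ S, w a with hM
  have hM0 : 0 ≤ M := Finset.sum_nonneg fun a _ => hw a
  set T := ∑ a ∈ S, ∑ b ∈ S, w a * (if g b ≠ g a ∧ r a b then w b else 0) with hT
  -- Exchanging the two summation variables shows that wins and losses have the same total weight.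
  have hT' : T = ∑ a ∈ S, ∑ b ∈ S, w a * (if g b ≠ g a ∧ r b a then w b else 0) := by
    rw [hT, Finset.sum_comm]
    refine Finset.sum_congr rfl fun a _ => Finset.sum_congr rfl fun b _ => ?_
    simp only [ne_comm (a := g a), mul_ite, mul_zero, mul_comm (w b) (w a)]
  have hTC : T ≤ M * C := by
    rw [hM, Finset.sum_mul, hT]
    refine Finset.sum_le_sum fun a ha => ?_
    rw [← Finset.mul_sum]
    exact mul_le_mul_of_nonneg_left (hC a ha) (hw a)
  have hE : ∑ a ∈ S, ∑ b ∈ S, w a * (if g b = g a then w b else 0) ≤ M := by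
    refine Finset.sum_le_sum fun a ha => ?_
    rw [← Finset.mul_sum, ← Finset.sum_filter]
    exact mul_le_of_le_one_right (hw a) (hg a ha)
  -- Every product `w a * w b` is charged to a win, to a loss, or to a common group.
  have hsq : M * M ≤ 2 * T + M := by
    calc M * M = ∑ a ∈ S, ∑ b ∈ S, w a * w b := by rw [hM, Finset.sum_mul_sum]
      _ ≤ ∑ a ∈ S, ∑ b ∈ S, (w a * (if g b ≠ g a ∧ r a b then w b else 0) +
          w a * (if g b ≠ g a ∧ r b a then w b else 0) +
          w a * (if g b = g a then w b else 0)) := by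
        refine Finset.sum_le_sum fun a ha => Finset.sum_le_sum fun b hb => ?_
        have h0 := mul_nonneg (hw a) (hw b)
        by_cases h : g b = g a
        · simp [h]
        · rcases hr a ha b hb h with h' | h'
          · simp only [ne_eq, h, not_false_eq_true, h', and_self, if_true, if_false, true_and]
            split_ifs <;> nlinarith
          · simp only [ne_eq, h, not_false_eq_true, h', and_self, if_true, if_false, true_and]
            split_ifs <;> nlinarith
      _ ≤ 2 * T + M := by
        simp only [Finset.sum_add_distrib]
        rw [← hT, ← hT']
        linarith
  -- Division by `M` needs `M > 0`. When `M = 0` the number `2 * C + 1` may be negative, which is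
  -- why `0 ≤ B` is assumed.
  rcases hM0.eq_or_lt with h | h
  · rw [← h]; exact hB
  · have : M * M ≤ M * (2 * C + 1) := by linarith
    exact (le_of_mul_le_mul_left this h).trans hCB

end Tournament

/-! ### Averages over pairs and the masses of the empirical distribution. -/

section Pairs

theorem card_indexPairs (n : ℕ) : (indexPairs n).card = n.choose 2 := by
  rw [Nat.choose_two_right, ← Finset.sum_range_id, indexPairs, Finset.card_filter,
    Fintype.sum_prod_type_right, ← Fin.sum_univ_eq_sum_range (fun i => i)]
  refine Finset.sum_congr rfl fun b _ => ?_
  rw [← Finset.card_filter, ← Fin.card_Iio]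
  congr 1
  ext a
  simp

theorem indexPairs_eq_empty {n : ℕ} (hn : ¬ 2 ≤ n) : indexPairs n = ∅ := by
  rw [← Finset.card_eq_zero, card_indexPairs, Nat.choose_eq_zero_of_lt (by omega)]

/-- The average of `f` over the pairs `i < i'`; it is zero when there is no such pair. -/
def pairMean (n : ℕ) (f : Fin n → Fin n → ℝ) : ℝ :=
  ∑ p ∈ indexPairs n, (n.choose 2 : ℝ)⁻¹ * f p.1 p.2

theorem pairMean_eq_zero {n : ℕ} (hn : ¬ 2 ≤ n) (f : Fin n → Fin n → ℝ) : pairMean n f = 0 := by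
  simp [pairMean, indexPairs_eq_empty hn]

theorem pairMean_const {n : ℕ} (hn : 2 ≤ n) (c : ℝ) : pairMean n (fun _ _ => c) = c := by
  have : (n.choose 2 : ℝ) ≠ 0 := by exact_mod_cast (Nat.choose_pos hn).ne'
  rw [pairMean, Finset.sum_const, card_indexPairs, nsmul_eq_mul]
  field_simp

theorem pairMean_mono {n : ℕ} {f f' : Fin n → Fin n → ℝ} (h : ∀ i j, f i j ≤ f' i j) :
    pairMean n f ≤ pairMean n f' :=
  Finset.sum_le_sum fun p _ => mul_le_mul_of_nonneg_left (h _ _) (by positivity)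

theorem pairMean_add {n : ℕ} (f f' : Fin n → Fin n → ℝ) :
    pairMean n (fun i j => f i j + f' i j) = pairMean n f + pairMean n f' := by
  simp [pairMean, mul_add, Finset.sum_add_distrib]

variable {𝒳 : Type*} {𝒴 : Set ℝ} {m : ℕ}

theorem sum_pairMean_bigGroups (d : Fin (m + 1) → Group 𝒳 𝒴)
    (f : (k : Fin (m + 1)) → Fin (d k).1.1 → Fin (d k).1.1 → ℝ) :
    ∑ k ∈ bigGroups d, pairMean _ (f k) = ∑ k, pairMean _ (f k) := by
  refine Finset.sum_subset (Finset.subset_univ _) fun k _ hk => ?_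
  exact pairMean_eq_zero (by simpa [bigGroups] using hk) _

theorem sum_pairMean_one (d : Fin (m + 1) → Group 𝒳 𝒴) :
    ∑ k, pairMean (d k).1.1 (fun _ _ => 1) = (bigGroups d).card := by
  rw [← sum_pairMean_bigGroups]
  rw [Finset.sum_congr rfl fun k hk => pairMean_const (by simpa [bigGroups] using hk) 1]
  simp

theorem pairDistribution_weight_ne_top (d : Fin (m + 1) → Group 𝒳 𝒴) {k : Fin (m + 1)}
    (hk : k ∈ bigGroups d) :
    ((((bigGroups d).card : ℝ≥0∞) + 1) * ((d k).1.1.choose 2 : ℝ≥0∞))⁻¹ ≠ ∞ := by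
  have hn : 2 ≤ (d k).1.1 := by simpa [bigGroups] using hk
  have hc : ((bigGroups d).card : ℝ≥0∞) + 1 ≠ 0 := by simp
  simp only [ne_eq, ENNReal.inv_eq_top, mul_eq_zero, hc, false_or]
  exact_mod_cast (Nat.choose_pos hn).ne'

instance isFiniteMeasure_pairDistribution (d : Fin (m + 1) → Group 𝒳 𝒴)
    (v : (k : Fin (m + 1)) → Fin (d k).1.1 → Fin (d k).1.1 → ℝ) (e : EReal) :
    IsFiniteMeasure (pairDistribution d v e) := by
  constructor
  rw [pairDistribution, Measure.add_apply, Measure.finsetSum_apply, ENNReal.add_lt_top]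
  refine ⟨ENNReal.sum_lt_top.2 fun k hk => ?_, ?_⟩
  · rw [Measure.finsetSum_apply]
    refine ENNReal.sum_lt_top.2 fun p _ => ?_
    rw [Measure.smul_apply]
    exact ENNReal.mul_lt_top (pairDistribution_weight_ne_top d hk).lt_top (measure_lt_top _ _)
  · rw [Measure.smul_apply]
    exact ENNReal.mul_lt_top (by simp) (measure_lt_top _ _)

/-- Clearing the denominator `K^{≥2} + 1` turns masses into real sums of pair averages. The sum may
run over all groups, since groups without pairs have average zero. -/
theorem pairDistribution_real (d : Fin (m + 1) → Group 𝒳 𝒴)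
    (v : (k : Fin (m + 1)) → Fin (d k).1.1 → Fin (d k).1.1 → ℝ) (e : EReal) {s : Set EReal}
    (hs : MeasurableSet s) :
    (pairDistribution d v e).real s * ((bigGroups d).card + 1) =
      (∑ k, pairMean _ fun i j => s.indicator 1 (v k i j : EReal)) + s.indicator 1 e := by
  classical
  have hc : ((bigGroups d).card : ℝ) + 1 ≠ 0 := by positivity
  have hfin : ∀ k ∈ bigGroups d, ∀ p : Fin (d k).1.1 × Fin (d k).1.1,
      (((((bigGroups d).card : ℝ≥0∞) + 1) * ((d k).1.1.choose 2 : ℝ≥0∞))⁻¹ •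
        Measure.dirac (v k p.1 p.2 : EReal)) s ≠ ∞ := by
    intro k hk p
    rw [Measure.smul_apply]
    exact ENNReal.mul_ne_top (pairDistribution_weight_ne_top d hk) (measure_ne_top _ _)
  have hfin' : ∀ k ∈ bigGroups d, (∑ p ∈ indexPairs (d k).1.1,
      ((((bigGroups d).card : ℝ≥0∞) + 1) * ((d k).1.1.choose 2 : ℝ≥0∞))⁻¹ •
        Measure.dirac (v k p.1 p.2 : EReal)) s ≠ ∞ := by
    intro k hk
    rw [Measure.finsetSum_apply]
    exact ENNReal.sum_ne_top.2 fun p _ => hfin k hk p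
  rw [← sum_pairMean_bigGroups, measureReal_def, pairDistribution, Measure.add_apply,
    Measure.finsetSum_apply, ENNReal.toReal_add (ENNReal.sum_ne_top.2 hfin')
      (by rw [Measure.smul_apply]; exact ENNReal.mul_ne_top (by simp) (measure_ne_top _ _)),
    ENNReal.toReal_sum hfin',
    add_mul, Finset.sum_mul]
  congr 1
  · refine Finset.sum_congr rfl fun k hk => ?_
    have hn : 2 ≤ (d k).1.1 := by simpa [bigGroups] using hk
    have hch : ((d k).1.1.choose 2 : ℝ) ≠ 0 := by exact_mod_cast (Nat.choose_pos hn).ne'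
    rw [Measure.finsetSum_apply, ENNReal.toReal_sum fun p _ => hfin k hk p, Finset.sum_mul,
      pairMean]
    refine Finset.sum_congr rfl fun p _ => ?_
    rw [Measure.smul_apply, Measure.dirac_apply' _ hs, smul_eq_mul, ENNReal.toReal_mul,
      ENNReal.toReal_inv, ENNReal.toReal_mul, ENNReal.toReal_add (by simp) (by simp)]
    simp only [ENNReal.toReal_natCast, ENNReal.toReal_one, Set.indicator_apply, Pi.one_apply]
    split_ifs
    · simp only [ENNReal.toReal_one]
      field_simp
    · simp
  · rw [Measure.smul_apply, Measure.dirac_apply' _ hs, smul_eq_mul, ENNReal.toReal_mul,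
      ENNReal.toReal_inv, ENNReal.toReal_add (by simp) (by simp)]
    simp only [ENNReal.toReal_natCast, ENNReal.toReal_one, Set.indicator_apply, Pi.one_apply]
    split_ifs
    · simp only [ENNReal.toReal_one]
      field_simp
    · simp

end Pairs

/-! ### The deterministic bound on uncovered pairs. -/

section Strange

variable {𝒳 : Type*} {𝒴 : Set ℝ} {m : ℕ}

/-- The data point `z` is not covered by the prediction interval built from `d`. -/
def Uncovered (α : ℝ) (A : (Fin m → Group 𝒳 𝒴) → 𝒳 → ℝ) (d : Fin (m + 1) → Group 𝒳 𝒴)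
    (z : 𝒳 × 𝒴) : Prop :=
  (z.2 : ℝ) ∉ predictionInterval α A d z.1

theorem lt_lowerEnd_iff (α : ℝ) (A : (Fin m → Group 𝒳 𝒴) → 𝒳 → ℝ) (d : Fin (m + 1) → Group 𝒳 𝒴)
    (x : 𝒳) (y : ℝ) :
    (y : EReal) < lowerEnd α A d x ↔ ∃ t : ℝ, y < t ∧ (pairDistribution d
      (fun k i i' => looModel A d k x - min (residual A d k i) (residual A d k i')) ⊥).real
        (Set.Iic (t : EReal)) ≤ α ^ 2 := by
  simp [lowerEnd, quantile', lt_sSup_iff, and_comm]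

theorem upperEnd_lt_iff (α : ℝ) (A : (Fin m → Group 𝒳 𝒴) → 𝒳 → ℝ) (d : Fin (m + 1) → Group 𝒳 𝒴)
    (x : 𝒳) (y : ℝ) :
    upperEnd α A d x < (y : EReal) ↔ ∃ t : ℝ, t < y ∧ 1 - α ^ 2 ≤ (pairDistribution d
      (fun k i i' => looModel A d k x + min (residual A d k i) (residual A d k i')) ⊤).real
        (Set.Iic (t : EReal)) := by
  simp [upperEnd, quantile, sInf_lt_iff, and_comm]

theorem uncovered_iff (α : ℝ) (A : (Fin m → Group 𝒳 𝒴) → 𝒳 → ℝ) (d : Fin (m + 1) → Group 𝒳 𝒴)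
    (z : 𝒳 × 𝒴) :
    Uncovered α A d z ↔
      ((z.2 : ℝ) : EReal) < lowerEnd α A d z.1 ∨ upperEnd α A d z.1 < ((z.2 : ℝ) : EReal) := by
  rw [Uncovered, predictionInterval, Set.mem_ofPred_eq, not_and_or, not_le, not_le]

open Classical in
/-- Few pairs of training residuals exceed the residual of an uncovered point. -/
theorem Uncovered.sum_pairMean_le {α : ℝ} {A : (Fin m → Group 𝒳 𝒴) → 𝒳 → ℝ}
    {d : Fin (m + 1) → Group 𝒳 𝒴} {z : 𝒳 × 𝒴} (h : Uncovered α A d z) :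
    ∑ k, pairMean _ (fun i j => if |(z.2 : ℝ) - looModel A d k z.1| ≤
        min (residual A d k i) (residual A d k j) then 1 else 0) + 1 ≤
      α ^ 2 * ((bigGroups d).card + 1) := by
  have hc : (0 : ℝ) < (bigGroups d).card + 1 := by positivity
  rcases (uncovered_iff α A d z).1 h with h | h
  · obtain ⟨t, hyt, ht⟩ := (lt_lowerEnd_iff α A d z.1 z.2).1 h
    refine le_trans ?_ (mul_le_mul_of_nonneg_right ht hc.le)
    rw [pairDistribution_real _ _ _ measurableSet_Iic, Set.indicator_of_mem (by simp),
      Pi.one_apply]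
    gcongr with k
    -- A pair counted on the left has `μ - min R ≤ μ - |y - μ| ≤ y < t`, so its atom lies below `t`;
    -- the extra `1` is the atom at `⊥`.
    refine pairMean_mono fun i j => ?_
    simp only [Set.indicator_apply, Pi.one_apply, Set.mem_Iic, EReal.coe_le_coe_iff]
    split_ifs with h1 h2 h2
    · rfl
    · exact absurd (by linarith [neg_abs_le ((z.2 : ℝ) - looModel A d k z.1)]) h2
    · exact zero_le_one
    · rfl
  · obtain ⟨t, hyt, ht⟩ := (upperEnd_lt_iff α A d z.1 z.2).1 h
    have h1 := mul_le_mul_of_nonneg_right ht hc.le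
    rw [pairDistribution_real _ _ _ measurableSet_Iic, Set.indicator_of_notMem (by simp),
      add_zero] at h1
    -- If `|y - μ| ≤ min R`, then `μ + min R ≥ y > t`, so the two indicators are never both one; the
    -- atom at `⊤` does not count towards the mass up to `t`.
    have h2 : ∑ k, pairMean _ (fun i j => if |(z.2 : ℝ) - looModel A d k z.1| ≤
        min (residual A d k i) (residual A d k j) then 1 else 0) +
        ∑ k, pairMean _ (fun i j => (Set.Iic (t : EReal)).indicator 1 ((looModel A d k z.1 +
          min (residual A d k i) (residual A d k j) : ℝ) : EReal)) ≤ (bigGroups d).card := by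
      rw [← sum_pairMean_one d, ← Finset.sum_add_distrib]
      refine Finset.sum_le_sum fun k _ => ?_
      rw [← pairMean_add]
      refine pairMean_mono fun i j => ?_
      simp only [Set.indicator_apply, Pi.one_apply, Set.mem_Iic, EReal.coe_le_coe_iff]
      split_ifs with h3 h4 h4
      · exact absurd h4 (by linarith [le_abs_self ((z.2 : ℝ) - looModel A d k z.1)])
      all_goals norm_num
    linarith

open Classical in
/-- The proportion of pairs of points of the group `g` that are both uncovered. -/
def jointlyUncovered (α : ℝ) (A : (Fin m → Group 𝒳 𝒴) → 𝒳 → ℝ) (d : Fin (m + 1) → Group 𝒳 𝒴)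
    (g : Group 𝒳 𝒴) : ℝ :=
  pairMean g.1.1 fun i j => if Uncovered α A d (g.2 i) ∧ Uncovered α A d (g.2 j) then 1 else 0

/-- The model trained on all groups of `w` but the `l`-th and the `k`-th. -/
def leaveTwoOut (A : (Fin m → Group 𝒳 𝒴) → 𝒳 → ℝ) (w : Fin (m + 2) → Group 𝒳 𝒴)
    (l k : Fin (m + 2)) : 𝒳 → ℝ :=
  open Classical in
  if h : ∃ j, l.succAbove j = k then looModel A (fun j => w (l.succAbove j)) h.choose
  -- Reached only for `k = l`; the tournament never compares pairs of the same group.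
  else fun _ => 0

theorem leaveTwoOut_succAbove (A : (Fin m → Group 𝒳 𝒴) → 𝒳 → ℝ) (w : Fin (m + 2) → Group 𝒳 𝒴)
    (l : Fin (m + 2)) (j : Fin (m + 1)) :
    leaveTwoOut A w l (l.succAbove j) = looModel A (fun j => w (l.succAbove j)) j := by
  have h : ∃ j', l.succAbove j' = l.succAbove j := ⟨j, rfl⟩
  rw [leaveTwoOut, dif_pos h, Fin.succAbove_right_injective h.choose_spec]

theorem leaveTwoOut_comm (A : (Fin m → Group 𝒳 𝒴) → 𝒳 → ℝ) (w : Fin (m + 2) → Group 𝒳 𝒴)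
    {l k : Fin (m + 2)} (hkl : k ≠ l) : leaveTwoOut A w l k = leaveTwoOut A w k l := by
  obtain ⟨j, rfl⟩ := Fin.exists_succAbove_eq hkl
  have h := leaveTwoOut_succAbove A w (l.succAbove j) (j.predAbove l)
  rw [Fin.succAbove_succAbove_predAbove] at h
  rw [h, leaveTwoOut_succAbove]
  simp only [looModel, Fin.succAbove_succAbove_succAbove_predAbove]

/-- The `+ 1` in the weights of the empirical distribution accounts for the test group, so the
normalisation is the same whichever large group is left out. -/
theorem card_bigGroups_succAbove (w : Fin (m + 2) → Group 𝒳 𝒴) {l : Fin (m + 2)}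
    (hl : 2 ≤ (w l).1.1) :
    (bigGroups fun j => w (l.succAbove j)).card + 1 = (bigGroups w).card := by
  simp only [bigGroups, Finset.card_filter]
  rw [Fin.sum_univ_succAbove (fun i => if 2 ≤ (w i).1.1 then 1 else 0) l, if_pos hl, add_comm]

/-- The smaller of the residuals of the points `a.2.1`, `a.2.2` in group `a.1`. -/
def minResidual (w : Fin (m + 2) → Group 𝒳 𝒴) (μ : 𝒳 → ℝ)
    (a : (l : Fin (m + 2)) × (Fin (w l).1.1 × Fin (w l).1.1)) : ℝ :=
  min |(((w a.1).2 a.2.1).2 : ℝ) - μ ((w a.1).2 a.2.1).1|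
    |(((w a.1).2 a.2.2).2 : ℝ) - μ ((w a.1).2 a.2.2).1|

theorem ite_min_le_add (a b c : ℝ) [Decidable (min a b ≤ c)] [Decidable (a ≤ c)]
    [Decidable (b ≤ c)] :
    (if min a b ≤ c then 1 else 0 : ℝ) ≤ (if a ≤ c then 1 else 0) + if b ≤ c then 1 else 0 := by
  split_ifs with h h1 h2 h2 <;> norm_num
  exact (min_le_iff.1 h).elim h1 h2

open Classical in
/-- Each group in turn serves as the test group. Leaving out groups keeps the order of the others,
so that the models agree without any symmetry of the algorithm. -/
theorem sum_jointlyUncovered_le (α : ℝ) (A : (Fin m → Group 𝒳 𝒴) → 𝒳 → ℝ)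
    (w : Fin (m + 2) → Group 𝒳 𝒴) :
    ∑ l, jointlyUncovered α A (fun j => w (l.succAbove j)) (w l) ≤
      4 * α ^ 2 * (bigGroups w).card := by
  let T : Finset ((l : Fin (m + 2)) × (Fin (w l).1.1 × Fin (w l).1.1)) :=
    Finset.univ.sigma fun l => indexPairs (w l).1.1
  let wt : ((l : Fin (m + 2)) × (Fin (w l).1.1 × Fin (w l).1.1)) → ℝ :=
    fun a => ((w a.1).1.1.choose 2 : ℝ)⁻¹
  let unc (l : Fin (m + 2)) (i : Fin (w l).1.1) : Prop :=
    Uncovered α A (fun j => w (l.succAbove j)) ((w l).2 i)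
  let S := T.filter fun a => unc a.1 a.2.1 ∧ unc a.1 a.2.2
  let r : ((l : Fin (m + 2)) × (Fin (w l).1.1 × Fin (w l).1.1)) →
      ((l : Fin (m + 2)) × (Fin (w l).1.1 × Fin (w l).1.1)) → Prop := fun a b =>
    minResidual w (leaveTwoOut A w a.1 b.1) a ≤ minResidual w (leaveTwoOut A w a.1 b.1) b
  have hwt : ∀ a, 0 ≤ wt a := fun a => by positivity
  have hS : ∑ l, jointlyUncovered α A (fun j => w (l.succAbove j)) (w l) = ∑ a ∈ S, wt a := by
    rw [Finset.sum_filter, Finset.sum_sigma]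
    simp only [jointlyUncovered, pairMean, mul_ite, mul_one, mul_zero, wt, unc]
  have hbig : ∀ a ∈ S, 2 ≤ (w a.1).1.1 := by
    intro a ha
    by_contra hn
    have := (Finset.mem_sigma.1 (Finset.mem_filter.1 ha).1).2
    rw [indexPairs_eq_empty hn] at this
    simp at this
  rw [hS]
  -- `C` is twice the bound for one uncovered point, so `2 * C + 1 = 4 α² n - 3`; the `-3` is
  -- discarded.
  refine tournament_weight_le S (fun a => a.1) wt hwt r ?_ ?_
    (C := 2 * (α ^ 2 * (bigGroups w).card - 1)) ?_ (by positivity) (by linarith)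
  · intro a _ b _ hab
    simp only [r]
    rw [leaveTwoOut_comm A w hab]
    exact le_total _ _
  · intro a ha
    calc ∑ b ∈ S with b.1 = a.1, wt b ≤ ∑ b ∈ T with b.1 = a.1, wt b :=
          Finset.sum_le_sum_of_subset_of_nonneg
            (Finset.filter_subset_filter _ (Finset.filter_subset _ _)) fun b _ _ => hwt b
      _ = ∑ l, if l = a.1 then pairMean (w l).1.1 (fun _ _ => 1) else 0 := by
          rw [Finset.sum_filter, Finset.sum_sigma]
          refine Finset.sum_congr rfl fun l _ => ?_
          split_ifs with h <;> simp [pairMean, wt, h]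
      _ ≤ 1 := by
          rw [Finset.sum_ite_eq' Finset.univ, if_pos (Finset.mem_univ _), pairMean_const (hbig a ha)]
  · intro a ha
    obtain ⟨l, p⟩ := a
    have hl : 2 ≤ (w l).1.1 := hbig _ ha
    obtain ⟨h1, h2⟩ := (Finset.mem_filter.1 ha).2
    have h1' := Uncovered.sum_pairMean_le h1
    have h2' := Uncovered.sum_pairMean_le h2
    have hcard : ((bigGroups fun j => w (l.succAbove j)).card : ℝ) + 1 = (bigGroups w).card := by
      exact_mod_cast card_bigGroups_succAbove w hl
    rw [hcard] at h1' h2'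
    calc ∑ b ∈ S, (if b.1 ≠ l ∧ r ⟨l, p⟩ b then wt b else 0)
        ≤ ∑ b ∈ T, (if b.1 ≠ l ∧ r ⟨l, p⟩ b then wt b else 0) :=
          Finset.sum_le_sum_of_subset_of_nonneg (Finset.filter_subset _ _) fun b _ _ => by
            split_ifs
            exacts [hwt b, le_rfl]
      _ = ∑ j, pairMean (w (l.succAbove j)).1.1 (fun i i' =>
            if r ⟨l, p⟩ ⟨l.succAbove j, (i, i')⟩ then 1 else 0) := by
          rw [Finset.sum_sigma, Fin.sum_univ_succAbove _ l]
          simp [pairMean, Fin.succAbove_ne, wt]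
      _ ≤ _ := by
          have h12 := add_le_add h1' h2'
          rw [add_add_add_comm, ← Finset.sum_add_distrib] at h12
          refine (Finset.sum_le_sum fun j _ => ?_).trans
            ((le_sub_iff_add_le.2 h12).trans (by linarith))
          rw [← pairMean_add]
          -- Union bound: if the smaller residual of `p` is at most that of the training pair, then
          -- so is the residual of one of the two points of `p`.
          refine pairMean_mono fun i i' => ?_
          simp only [r, minResidual, leaveTwoOut_succAbove]
          exact ite_min_le_add _ _ _

end Strange

/-! ### Measurability of the uncovered event. -/

section Measurability

variable {𝒳 : Type*} {𝒴 : Set ℝ} {m : ℕ}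

/-- The data point with index `i` of a group, or its last data point if there are too few. -/
def nthPoint (g : Group 𝒳 𝒴) (i : ℕ) : 𝒳 × 𝒴 :=
  g.2 ⟨min i (g.1.1 - 1), by have := g.1.2; omega⟩

theorem nthPoint_val (g : Group 𝒳 𝒴) (i : Fin g.1.1) : nthPoint g i = g.2 i := by
  exact congrArg g.2 (Fin.ext (min_eq_left (Nat.le_sub_one_of_lt i.2)))

variable [MeasurableSpace 𝒳] {W : Type*} [MeasurableSpace W]

theorem measurable_group_of_forall {β : Type*} [MeasurableSpace β] {f : Group 𝒳 𝒴 → β}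
    (h : ∀ n, Measurable fun z : Fin n.1 → 𝒳 × 𝒴 => f ⟨n, z⟩) : Measurable f :=
  fun _ hs => MeasurableSpace.measurableSet_iInf.2 fun n => h n hs

theorem measurable_groupSize : Measurable fun g : Group 𝒳 𝒴 => g.1 :=
  measurable_group_of_forall fun _ => measurable_const

theorem measurable_nthPoint (i : ℕ) : Measurable fun g : Group 𝒳 𝒴 => nthPoint g i :=
  measurable_group_of_forall fun n => by
    let k : Fin n.1 := ⟨min i (n.1 - 1), by have := n.2; omega⟩
    exact measurable_pi_apply k

/-- The index set varies with the group size. Totalising the points by `nthPoint` allows the size,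
which takes countably many values, to be fixed first. -/
theorem measurable_pairMean {γ : W → Group 𝒳 𝒴} (hγ : Measurable γ)
    {φ : W × (𝒳 × 𝒴) × (𝒳 × 𝒴) → ℝ} (hφ : Measurable φ) :
    Measurable fun w => pairMean (γ w).1.1 fun i j => φ (w, (γ w).2 i, (γ w).2 j) := by
  have h : Measurable fun q : GroupSize × W => pairMean q.1.1 fun i j =>
      φ (q.2, nthPoint (γ q.2) i, nthPoint (γ q.2) j) := by
    refine measurable_from_prod_countable_right fun n => ?_
    simp only [pairMean]
    refine Finset.measurable_sum _ fun p _ => Measurable.const_mul ?_ _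
    exact hφ.comp (measurable_id.prodMk
      (((measurable_nthPoint _).comp hγ).prodMk ((measurable_nthPoint _).comp hγ)))
  have h' := h.comp ((measurable_groupSize.comp hγ).prodMk measurable_id)
  convert h' using 3 with w
  simp [nthPoint_val]

theorem measurable_card_bigGroups :
    Measurable fun d : Fin (m + 1) → Group 𝒳 𝒴 => ((bigGroups d).card : ℝ) := by
  simp only [← sum_pairMean_one]
  exact Finset.measurable_sum _ fun k _ =>
    measurable_pairMean (measurable_pi_apply k) (φ := fun _ => 1) measurable_const

variable {A : (Fin m → Group 𝒳 𝒴) → 𝒳 → ℝ}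

theorem measurable_looModel
    (hA : Measurable fun p : (Fin m → Group 𝒳 𝒴) × 𝒳 => A p.1 p.2) (k : Fin (m + 1)) :
    Measurable fun p : (Fin (m + 1) → Group 𝒳 𝒴) × 𝒳 => looModel A p.1 k p.2 := by
  have h : Measurable fun p : (Fin (m + 1) → Group 𝒳 𝒴) × 𝒳 =>
      ((fun j => p.1 (k.succAbove j) : Fin m → Group 𝒳 𝒴), p.2) := by fun_prop
  exact hA.comp h

theorem measurable_pairDistribution_real
    (hA : Measurable fun p : (Fin m → Group 𝒳 𝒴) × 𝒳 => A p.1 p.2)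
    {s : Set EReal} (hs : MeasurableSet s) (e : EReal)
    {φ : ℝ × ℝ → ℝ} (hφ : Measurable φ) :
    Measurable fun p : (Fin (m + 1) → Group 𝒳 𝒴) × 𝒳 => (pairDistribution p.1
      (fun k i j => φ (looModel A p.1 k p.2, min (residual A p.1 k i) (residual A p.1 k j)))
        e).real s := by
  have h : ∀ p : (Fin (m + 1) → Group 𝒳 𝒴) × 𝒳, (pairDistribution p.1
      (fun k i j => φ (looModel A p.1 k p.2, min (residual A p.1 k i) (residual A p.1 k j)))
        e).real s = ((∑ k, pairMean _ fun i j => s.indicator 1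
          (φ (looModel A p.1 k p.2, min (residual A p.1 k i) (residual A p.1 k j)) : EReal)) +
            s.indicator 1 e) / ((bigGroups p.1).card + 1) := fun p => by
    rw [← pairDistribution_real _ _ _ hs, mul_div_cancel_right₀]
    positivity
  simp only [h]
  refine ((Finset.measurable_sum _ fun k _ => ?_).add_const _).div
    ((measurable_card_bigGroups.comp measurable_fst).add_const 1)
  have hl := measurable_looModel hA k
  refine measurable_pairMean (W := (Fin (m + 1) → Group 𝒳 𝒴) × 𝒳) (γ := fun p => p.1 k)
    (φ := fun q => s.indicator 1 ((φ (looModel A q.1.1 k q.1.2,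
      min |(q.2.1.2 : ℝ) - looModel A q.1.1 k q.2.1.1|
        |(q.2.2.2 : ℝ) - looModel A q.1.1 k q.2.2.1|) : ℝ) : EReal)) (by fun_prop) ?_
  refine (measurable_one.indicator hs).comp (measurable_coe_real_ereal.comp (hφ.comp ?_))
  have h0 : Measurable fun q : ((Fin (m + 1) → Group 𝒳 𝒴) × 𝒳) × (𝒳 × 𝒴) × (𝒳 × 𝒴) =>
      looModel A q.1.1 k q.1.2 := hl.comp measurable_fst
  have h1 : Measurable fun q : ((Fin (m + 1) → Group 𝒳 𝒴) × 𝒳) × (𝒳 × 𝒴) × (𝒳 × 𝒴) =>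
      looModel A q.1.1 k q.2.1.1 :=
      hl.comp (f := fun q : ((Fin (m + 1) → Group 𝒳 𝒴) × 𝒳) × (𝒳 × 𝒴) × (𝒳 × 𝒴) =>
          (q.1.1, q.2.1.1)) (by fun_prop)
  have h2 : Measurable fun q : ((Fin (m + 1) → Group 𝒳 𝒴) × 𝒳) × (𝒳 × 𝒴) × (𝒳 × 𝒴) =>
      looModel A q.1.1 k q.2.2.1 :=
      hl.comp (f := fun q : ((Fin (m + 1) → Group 𝒳 𝒴) × 𝒳) × (𝒳 × 𝒴) × (𝒳 × 𝒴) =>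
          (q.1.1, q.2.2.1)) (by fun_prop)
  have h3 : Measurable fun q : ((Fin (m + 1) → Group 𝒳 𝒴) × 𝒳) × (𝒳 × 𝒴) × (𝒳 × 𝒴) =>
      (q.2.1.2 : ℝ) := measurable_subtype_coe.comp (by fun_prop)
  have h4 : Measurable fun q : ((Fin (m + 1) → Group 𝒳 𝒴) × 𝒳) × (𝒳 × 𝒴) × (𝒳 × 𝒴) =>
      (q.2.2.2 : ℝ) := measurable_subtype_coe.comp (by fun_prop)
  exact h0.prodMk ((h3.sub h1).abs.min (h4.sub h2).abs)

theorem measurableSet_uncovered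
    (hA : Measurable fun p : (Fin m → Group 𝒳 𝒴) × 𝒳 => A p.1 p.2) (α : ℝ) :
    MeasurableSet {q : (Fin (m + 1) → Group 𝒳 𝒴) × (𝒳 × 𝒴) | Uncovered α A q.1 q.2} := by
  obtain ⟨low, hlow, hlow_meas⟩ : ∃ low : ℚ → (Fin (m + 1) → Group 𝒳 𝒴) × 𝒳 → ℝ,
      (∀ t p, low t p = (pairDistribution p.1
        (fun k i j => looModel A p.1 k p.2 - min (residual A p.1 k i) (residual A p.1 k j))
          ⊥).real (Set.Iic ((t : ℝ) : EReal))) ∧ ∀ t, Measurable (low t) :=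
    ⟨_, fun _ _ => rfl, fun t => measurable_pairDistribution_real hA measurableSet_Iic ⊥
      (φ := fun u => u.1 - u.2) (by fun_prop)⟩
  obtain ⟨upp, hupp, hupp_meas⟩ : ∃ upp : ℚ → (Fin (m + 1) → Group 𝒳 𝒴) × 𝒳 → ℝ,
      (∀ t p, upp t p = (pairDistribution p.1
        (fun k i j => looModel A p.1 k p.2 + min (residual A p.1 k i) (residual A p.1 k j))
          ⊤).real (Set.Iic ((t : ℝ) : EReal))) ∧ ∀ t, Measurable (upp t) :=
    ⟨_, fun _ _ => rfl, fun t => measurable_pairDistribution_real hA measurableSet_Iic ⊤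
      (φ := fun u => u.1 + u.2) (by fun_prop)⟩
  have hproj : Measurable fun q : (Fin (m + 1) → Group 𝒳 𝒴) × (𝒳 × 𝒴) => (q.1, q.2.1) := by
    fun_prop
  have hy : Measurable fun q : (Fin (m + 1) → Group 𝒳 𝒴) × (𝒳 × 𝒴) => (q.2.2 : ℝ) :=
    measurable_subtype_coe.comp (by fun_prop)
  -- Masses of `Set.Iic t` are monotone in `t`, so a real threshold can be moved to a rational one
  -- strictly between it and `y`; the unions become countable.
  have heq : {q : (Fin (m + 1) → Group 𝒳 𝒴) × (𝒳 × 𝒴) | Uncovered α A q.1 q.2} =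
      (⋃ t : ℚ, {q | (q.2.2 : ℝ) < t} ∩ {q | low t (q.1, q.2.1) ≤ α ^ 2}) ∪
      (⋃ t : ℚ, {q | (t : ℝ) < (q.2.2 : ℝ)} ∩ {q | 1 - α ^ 2 ≤ upp t (q.1, q.2.1)}) := by
    ext q
    simp only [Set.mem_ofPred_eq, uncovered_iff, lt_lowerEnd_iff, upperEnd_lt_iff, Set.mem_union,
      Set.mem_iUnion, Set.mem_inter_iff, hlow, hupp]
    refine or_congr ⟨?_, fun ⟨t, h⟩ => ⟨t, h⟩⟩ ⟨?_, fun ⟨t, h⟩ => ⟨t, h⟩⟩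
    · rintro ⟨t, hyt, ht⟩
      obtain ⟨u, hu, hut⟩ := exists_rat_btwn hyt
      exact ⟨u, hu, (measureReal_mono (Set.Iic_subset_Iic.2 (by exact_mod_cast hut.le))).trans ht⟩
    · rintro ⟨t, hyt, ht⟩
      obtain ⟨u, hu, hut⟩ := exists_rat_btwn hyt
      exact ⟨u, hut, ht.trans (measureReal_mono (Set.Iic_subset_Iic.2 (by exact_mod_cast hu.le)))⟩
  rw [heq]
  refine MeasurableSet.union (.iUnion fun t => ?_) (.iUnion fun t => ?_)
  · exact (measurableSet_lt hy measurable_const).inter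
      (measurableSet_le ((hlow_meas t).comp hproj) measurable_const)
  · exact (measurableSet_lt measurable_const hy).inter
      (measurableSet_le measurable_const ((hupp_meas t).comp hproj))

theorem measurable_jointlyUncovered
    (hA : Measurable fun p : (Fin m → Group 𝒳 𝒴) × 𝒳 => A p.1 p.2) (α : ℝ) :
    Measurable fun q : Group 𝒳 𝒴 × (Fin (m + 1) → Group 𝒳 𝒴) =>
      jointlyUncovered α A q.2 q.1 := by
  have hm := measurableSet_uncovered hA α
  refine measurable_pairMean (W := Group 𝒳 𝒴 × (Fin (m + 1) → Group 𝒳 𝒴)) measurable_fst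
    (φ := fun q => open Classical in
      if Uncovered α A q.1.2 q.2.1 ∧ Uncovered α A q.1.2 q.2.2 then 1 else 0) ?_
  refine Measurable.ite (MeasurableSet.inter ?_ ?_) measurable_const measurable_const
  · exact hm.preimage (f := fun q : (Group 𝒳 𝒴 × (Fin (m + 1) → Group 𝒳 𝒴)) ×
      (𝒳 × 𝒴) × (𝒳 × 𝒴) => (q.1.2, q.2.1)) (by fun_prop)
  · exact hm.preimage (f := fun q : (Group 𝒳 𝒴 × (Fin (m + 1) → Group 𝒳 𝒴)) ×
      (𝒳 × 𝒴) × (𝒳 × 𝒴) => (q.1.2, q.2.2)) (by fun_prop)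

end Measurability

/-! ### From uncovered pairs to the second moment. -/

section Moments

variable {𝒳 : Type*} [MeasurableSpace 𝒳] {𝒴 : Set ℝ} {m : ℕ}

theorem measurableSet_atLeastTwo : MeasurableSet (atLeastTwo 𝒳) :=
  measurable_snd (t := {n : GroupSize | 2 ≤ n.1}) (MeasurableSet.of_discrete)

theorem pi_setOf_mem_and_mem {β : Type*} [MeasurableSpace β] (μ : Measure β)
    [IsProbabilityMeasure μ] {n : ℕ} {i j : Fin n} (hij : i ≠ j) (s : Set β) :
    Measure.pi (fun _ : Fin n => μ) {y | y i ∈ s ∧ y j ∈ s} = μ s ^ 2 := by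
  classical
  have h : {y : Fin n → β | y i ∈ s ∧ y j ∈ s} =
      Set.univ.pi fun k => if k ∈ ({i, j} : Finset (Fin n)) then s else Set.univ := by
    ext y
    simp only [Set.mem_ofPred_eq, Set.mem_pi, Set.mem_univ, true_imp_iff]
    refine ⟨fun hy k => ?_, fun hy => ⟨?_, ?_⟩⟩
    · split_ifs with hk
      · rcases Finset.mem_insert.1 hk with rfl | hk
        · exact hy.1
        · rw [Finset.mem_singleton.1 hk]; exact hy.2
      · trivial
    · simpa using hy i
    · simpa using hy j
  have h' : ∀ k, μ (if k ∈ ({i, j} : Finset (Fin n)) then s else Set.univ) =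
      if k ∈ ({i, j} : Finset (Fin n)) then μ s else 1 := fun k => by
    split_ifs <;> simp
  rw [h, Measure.pi_pi]
  simp only [h']
  rw [Finset.prod_ite_mem, Finset.univ_inter, Finset.prod_pair hij, sq]

theorem measurable_mkGroup_right (x : 𝒳) (n : GroupSize) :
    Measurable (mkGroup (𝒴 := 𝒴) x n) :=
  (measurable_mkGroup n).comp measurable_prodMk_left

variable {A : (Fin m → Group 𝒳 𝒴) → 𝒳 → ℝ}

theorem measurableSet_uncovered_right
    (hA : Measurable fun p : (Fin m → Group 𝒳 𝒴) × 𝒳 => A p.1 p.2) (α : ℝ)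
    (d : Fin (m + 1) → Group 𝒳 𝒴) (x : 𝒳) : MeasurableSet {y : 𝒴 | Uncovered α A d (x, y)} :=
  (measurableSet_uncovered hA α).preimage (f := fun y : 𝒴 => (d, x, y)) (by fun_prop)

/-- Given `(x, n)`, each pair `i < i'` is uncovered with probability `PY x U ^ 2` by independence,
hence so is the average; for `n < 2` there is no pair, which produces the indicator. -/
theorem lintegral_jointlyUncovered_groupLawGiven
    (hA : Measurable fun p : (Fin m → Group 𝒳 𝒴) × 𝒳 => A p.1 p.2) (PY : Kernel 𝒳 𝒴)
    [IsMarkovKernel PY] (α : ℝ) (d : Fin (m + 1) → Group 𝒳 𝒴) (p : 𝒳 × GroupSize) :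
    ∫⁻ g, ENNReal.ofReal (jointlyUncovered α A d g) ∂groupLawGiven PY p =
      (atLeastTwo 𝒳).indicator (fun p => PY p.1 {y | Uncovered α A d (p.1, y)} ^ 2) p := by
  classical
  obtain ⟨x, n⟩ := p
  have hm : Measurable fun g => ENNReal.ofReal (jointlyUncovered α A d g) :=
    ((measurable_jointlyUncovered hA α).comp measurable_prodMk_right).ennreal_ofReal
  set U : Set 𝒴 := {y | Uncovered α A d (x, y)}
  have hUm : MeasurableSet U := measurableSet_uncovered_right hA α d x
  rw [groupLawGiven, lintegral_map hm (measurable_mkGroup_right x n)]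
  have hval : ∀ y : Fin n.1 → 𝒴, ENNReal.ofReal (jointlyUncovered α A d (mkGroup x n y)) =
      ∑ q ∈ indexPairs n.1, ENNReal.ofReal (n.1.choose 2 : ℝ)⁻¹ *
        {y : Fin n.1 → 𝒴 | y q.1 ∈ U ∧ y q.2 ∈ U}.indicator 1 y := fun y => by
    simp only [jointlyUncovered, mkGroup, pairMean]
    rw [ENNReal.ofReal_sum_of_nonneg fun q _ => by positivity]
    refine Finset.sum_congr rfl fun q _ => ?_
    rw [ENNReal.ofReal_mul (by positivity)]
    congr 1
    by_cases h : y q.1 ∈ U ∧ y q.2 ∈ U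
    · rw [Set.indicator_of_mem (by exact h)]
      exact (congrArg ENNReal.ofReal (if_pos h)).trans ENNReal.ofReal_one
    · rw [Set.indicator_of_notMem (by exact h)]
      exact (congrArg ENNReal.ofReal (if_neg h)).trans ENNReal.ofReal_zero
  have hpair : ∀ q : Fin n.1 × Fin n.1,
      MeasurableSet {y : Fin n.1 → 𝒴 | y q.1 ∈ U ∧ y q.2 ∈ U} := fun q =>
    (hUm.preimage (measurable_pi_apply q.1)).inter (hUm.preimage (measurable_pi_apply q.2))
  simp only [hval]
  rw [lintegral_finsetSum _ fun q _ => (measurable_one.indicator (hpair q)).const_mul _]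
  have hterm : ∀ q ∈ indexPairs n.1, ∫⁻ y, ENNReal.ofReal (n.1.choose 2 : ℝ)⁻¹ *
      {y : Fin n.1 → 𝒴 | y q.1 ∈ U ∧ y q.2 ∈ U}.indicator 1 y
        ∂Measure.pi (fun _ : Fin n.1 => PY x) =
      ENNReal.ofReal (n.1.choose 2 : ℝ)⁻¹ * PY x U ^ 2 := fun q hq => by
    rw [lintegral_const_mul _ (measurable_one.indicator (hpair q)),
      lintegral_indicator_one (hpair q), pi_setOf_mem_and_mem _ (by
        have : q.1 < q.2 := by simpa [indexPairs] using hq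
        exact this.ne)]
  rw [Finset.sum_congr rfl hterm, Finset.sum_const, card_indexPairs]
  by_cases hn : 2 ≤ n.1
  · rw [Set.indicator_of_mem (by exact hn)]
    have h0 : 0 < n.1.choose 2 := Nat.choose_pos hn
    rw [nsmul_eq_mul, ← mul_assoc, ENNReal.ofReal_inv_of_pos (by exact_mod_cast h0),
      ENNReal.ofReal_natCast, ENNReal.mul_inv_cancel (by exact_mod_cast h0.ne') (by simp), one_mul]
  · rw [Set.indicator_of_notMem (by exact hn), Nat.choose_eq_zero_of_lt (by omega), zero_smul]

theorem lintegral_jointlyUncovered_groupLaw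
    (hA : Measurable fun p : (Fin m → Group 𝒳 𝒴) × 𝒳 => A p.1 p.2) (PX : Measure 𝒳)
    (PN : Kernel 𝒳 GroupSize) (PY : Kernel 𝒳 𝒴) [IsMarkovKernel PY] (α : ℝ)
    (d : Fin (m + 1) → Group 𝒳 𝒴) :
    ∫⁻ g, ENNReal.ofReal (jointlyUncovered α A d g) ∂groupLaw PX PN PY =
      ∫⁻ p in atLeastTwo 𝒳, PY p.1 {y | Uncovered α A d (p.1, y)} ^ 2 ∂(PX ⊗ₘ PN) := by
  have hm : Measurable fun g => ENNReal.ofReal (jointlyUncovered α A d g) :=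
    ((measurable_jointlyUncovered hA α).comp measurable_prodMk_right).ennreal_ofReal
  rw [groupLaw, Measure.lintegral_bind (measurable_groupLawGiven PY).aemeasurable hm.aemeasurable,
    ← lintegral_indicator measurableSet_atLeastTwo]
  simp only [lintegral_jointlyUncovered_groupLawGiven hA]

theorem groupLaw_two_le (PX : Measure 𝒳) (PN : Kernel 𝒳 GroupSize) (PY : Kernel 𝒳 𝒴)
    [IsMarkovKernel PY] :
    groupLaw PX PN PY {g | 2 ≤ g.1.1} = (PX ⊗ₘ PN) (atLeastTwo 𝒳) := by
  classical
  have hs : MeasurableSet {g : Group 𝒳 𝒴 | 2 ≤ g.1.1} :=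
    measurable_groupSize (t := {n : GroupSize | 2 ≤ n.1}) MeasurableSet.of_discrete
  rw [groupLaw, Measure.bind_apply hs (measurable_groupLawGiven PY).aemeasurable,
    ← lintegral_indicator_one measurableSet_atLeastTwo]
  refine lintegral_congr fun p => ?_
  rw [groupLawGiven, Measure.map_apply (measurable_mkGroup_right p.1 p.2) hs]
  by_cases hp : 2 ≤ p.2.1
  · rw [Set.indicator_of_mem (by exact hp)]
    simp [mkGroup, Set.preimage, hp]
  · rw [Set.indicator_of_notMem (by exact hp)]
    simp [mkGroup, Set.preimage, hp]

theorem lintegral_featureLawGeTwo (PX : Measure 𝒳) (PN : Kernel 𝒳 GroupSize) {f : 𝒳 → ℝ≥0∞}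
    (hf : Measurable f) :
    ∫⁻ x, f x ∂featureLawGeTwo PX PN =
      ((PX ⊗ₘ PN) (atLeastTwo 𝒳))⁻¹ * ∫⁻ p in atLeastTwo 𝒳, f p.1 ∂(PX ⊗ₘ PN) := by
  rw [featureLawGeTwo, lintegral_map hf measurable_fst, ProbabilityTheory.cond,
    lintegral_smul_measure, smul_eq_mul]

/-- Exchangeability: singling out any of `m + 2` i.i.d. groups gives the same integral `I`.
Integrating the deterministic bound gives `m + 2` copies of `I` on one side and `m + 2` copies of
the probability of a large group on the other. -/
theorem lintegral_jointlyUncovered_le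
    (hA : Measurable fun p : (Fin m → Group 𝒳 𝒴) × 𝒳 => A p.1 p.2)
    (ν : Measure (Group 𝒳 𝒴)) [IsProbabilityMeasure ν] (α : ℝ) :
    ∫⁻ d, ∫⁻ g, ENNReal.ofReal (jointlyUncovered α A d g) ∂ν
        ∂Measure.pi (fun _ : Fin (m + 1) => ν) ≤
      ENNReal.ofReal (4 * α ^ 2) * ν {g | 2 ≤ g.1.1} := by
  classical
  set J : Group 𝒳 𝒴 × (Fin (m + 1) → Group 𝒳 𝒴) → ℝ≥0∞ := fun q =>
    ENNReal.ofReal (jointlyUncovered α A q.2 q.1) with hJ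
  have hJm : Measurable J := (measurable_jointlyUncovered hA α).ennreal_ofReal
  set s : Set (Group 𝒳 𝒴) := {g | 2 ≤ g.1.1}
  have hs : MeasurableSet s :=
    measurable_groupSize (t := {n : GroupSize | 2 ≤ n.1}) MeasurableSet.of_discrete
  set I := ∫⁻ d, ∫⁻ g, ENNReal.ofReal (jointlyUncovered α A d g) ∂ν
    ∂Measure.pi (fun _ : Fin (m + 1) => ν) with hI
  have hl : ∀ l : Fin (m + 2), ∫⁻ w, J (w l, fun j => w (l.succAbove j))
      ∂Measure.pi (fun _ : Fin (m + 2) => ν) = I := fun l => by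
    have h := (measurePreserving_piFinSuccAbove (fun _ : Fin (m + 2) => ν) l).lintegral_comp hJm
    rw [hI, ← lintegral_prod_symm' J hJm]
    exact h
  have hJl : ∀ l : Fin (m + 2), Measurable fun w : Fin (m + 2) → Group 𝒳 𝒴 =>
      J (w l, fun j => w (l.succAbove j)) := fun l => hJm.comp (by fun_prop)
  have hnonneg : ∀ (d : Fin (m + 1) → Group 𝒳 𝒴) g, 0 ≤ jointlyUncovered α A d g := fun d g =>
    Finset.sum_nonneg fun p _ => by positivity
  have hpt : ∀ w : Fin (m + 2) → Group 𝒳 𝒴, ∑ l, J (w l, fun j => w (l.succAbove j)) ≤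
      ENNReal.ofReal (4 * α ^ 2) * ∑ l, s.indicator 1 (w l) := fun w => by
    rw [hJ, ← ENNReal.ofReal_sum_of_nonneg fun l _ => hnonneg _ _]
    refine (ENNReal.ofReal_le_ofReal (sum_jointlyUncovered_le α A w)).trans ?_
    rw [ENNReal.ofReal_mul (by positivity), ENNReal.ofReal_natCast, bigGroups, Finset.card_filter]
    simp [s, Set.indicator_apply]
  have hsum := lintegral_mono (μ := Measure.pi fun _ : Fin (m + 2) => ν) hpt
  have hev : ∀ l : Fin (m + 2), ∫⁻ w, s.indicator (1 : Group 𝒳 𝒴 → ℝ≥0∞) (w l)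
      ∂Measure.pi (fun _ : Fin (m + 2) => ν) = ν s := fun l => by
    rw [← lintegral_indicator_one hs]
    exact (measurePreserving_eval (fun _ : Fin (m + 2) => ν) l).lintegral_comp
      (measurable_one.indicator hs)
  have hind : ∀ l : Fin (m + 2), Measurable fun w : Fin (m + 2) → Group 𝒳 𝒴 =>
      s.indicator (1 : Group 𝒳 𝒴 → ℝ≥0∞) (w l) := fun l =>
    (measurable_one.indicator hs).comp (measurable_pi_apply l)
  rw [lintegral_finsetSum _ fun l _ => hJl l,
    lintegral_const_mul _ (Finset.measurable_sum _ fun l _ => hind l),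
    lintegral_finsetSum _ fun l _ => hind l] at hsum
  simp only [hl, hev, Finset.sum_const, Finset.card_univ, Fintype.card_fin, nsmul_eq_mul] at hsum
  rw [mul_left_comm] at hsum
  exact (ENNReal.mul_le_mul_iff_right (by simp) (by simp)).1 hsum

theorem measurable_kernel_uncovered
    (hA : Measurable fun p : (Fin m → Group 𝒳 𝒴) × 𝒳 => A p.1 p.2) (PY : Kernel 𝒳 𝒴)
    [IsMarkovKernel PY] (α : ℝ) :
    Measurable fun p : (Fin (m + 1) → Group 𝒳 𝒴) × 𝒳 =>
      PY p.2 {y | Uncovered α A p.1 (p.2, y)} :=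
  Kernel.measurable_kernel_prodMk_left
    (κ := PY.comap (Prod.snd : (Fin (m + 1) → Group 𝒳 𝒴) × 𝒳 → 𝒳) measurable_snd)
    ((measurableSet_uncovered hA α).preimage
      (f := fun q : ((Fin (m + 1) → Group 𝒳 𝒴) × 𝒳) × 𝒴 => (q.1.1, q.1.2, q.2)) (by fun_prop))

theorem lintegral_kernel_uncovered_sq_le
    (hA : Measurable fun p : (Fin m → Group 𝒳 𝒴) × 𝒳 => A p.1 p.2) (PX : Measure 𝒳)
    [IsProbabilityMeasure PX] (PN : Kernel 𝒳 GroupSize) [IsMarkovKernel PN] (PY : Kernel 𝒳 𝒴)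
    [IsMarkovKernel PY] (hN : 0 < (PX ⊗ₘ PN) (atLeastTwo 𝒳)) (α : ℝ) :
    ∫⁻ d, ∫⁻ x, PY x {y | Uncovered α A d (x, y)} ^ 2 ∂featureLawGeTwo PX PN
        ∂Measure.pi (fun _ : Fin (m + 1) => groupLaw PX PN PY) ≤ ENNReal.ofReal (4 * α ^ 2) := by
  have hm : ∀ d, Measurable fun x => PY x {y | Uncovered α A d (x, y)} ^ 2 := fun d =>
    ((measurable_kernel_uncovered hA PY α).comp measurable_prodMk_left).pow_const 2
  have hmJ : Measurable fun d => ∫⁻ g, ENNReal.ofReal (jointlyUncovered α A d g)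
      ∂groupLaw PX PN PY :=
    (measurable_jointlyUncovered hA α).ennreal_ofReal.lintegral_prod_left'
  simp only [lintegral_featureLawGeTwo PX PN (hm _),
    ← lintegral_jointlyUncovered_groupLaw hA PX PN PY α]
  rw [lintegral_const_mul _ hmJ]
  calc _ ≤ ((PX ⊗ₘ PN) (atLeastTwo 𝒳))⁻¹ *
        (ENNReal.ofReal (4 * α ^ 2) * groupLaw PX PN PY {g | 2 ≤ g.1.1}) := by
        gcongr
        exact lintegral_jointlyUncovered_le hA _ α
    _ = ENNReal.ofReal (4 * α ^ 2) := by
        -- The normalising constant of the conditioning on `N ≥ 2` cancels the probability that a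
        -- group is large.
        rw [groupLaw_two_le, mul_left_comm, ENNReal.inv_mul_cancel hN.ne' (measure_ne_top _ _),
          mul_one]

theorem ofReal_miscoverage_sq (PY : Kernel 𝒳 𝒴) [IsMarkovKernel PY] (α : ℝ)
    (d : Fin (m + 1) → Group 𝒳 𝒴) (x : 𝒳) :
    ENNReal.ofReal (miscoverage PY α A d x ^ 2) = PY x {y | Uncovered α A d (x, y)} ^ 2 := by
  rw [miscoverage, ENNReal.ofReal_pow measureReal_nonneg, ofReal_measureReal]
  rfl

theorem isProbabilityMeasure_featureLawGeTwo (PX : Measure 𝒳) [IsProbabilityMeasure PX]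
    (PN : Kernel 𝒳 GroupSize) [IsMarkovKernel PN] (hN : 0 < (PX ⊗ₘ PN) (atLeastTwo 𝒳)) :
    IsProbabilityMeasure (featureLawGeTwo PX PN) := by
  have := cond_isProbabilityMeasure hN.ne'
  exact Measure.isProbabilityMeasure_map measurable_fst.aemeasurable

theorem measurable_miscoverage
    (hA : Measurable fun p : (Fin m → Group 𝒳 𝒴) × 𝒳 => A p.1 p.2) (PY : Kernel 𝒳 𝒴)
    [IsMarkovKernel PY] (α : ℝ) :
    Measurable fun p : (Fin (m + 1) → Group 𝒳 𝒴) × 𝒳 => miscoverage PY α A p.1 p.2 :=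
  (measurable_kernel_uncovered hA PY α).ennreal_toReal

end Moments

end HierJackknife

end

/-! ### Transfer to the random data set. -/

theorem theorem6 {Ω 𝒳 : Type*} [MeasurableSpace Ω] [MeasurableSpace 𝒳] {𝒴 : Set ℝ}
    (P : Measure Ω) [IsProbabilityMeasure P]
    (PX : Measure 𝒳) [IsProbabilityMeasure PX]
    (PN : Kernel 𝒳 HierJackknife.GroupSize) [IsMarkovKernel PN]
    (PY : Kernel 𝒳 𝒴) [IsMarkovKernel PY]
    (hN : 0 < (PX ⊗ₘ PN) (HierJackknife.atLeastTwo 𝒳))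
    {m : ℕ} (A : (Fin m → HierJackknife.Group 𝒳 𝒴) → 𝒳 → ℝ)
    (hA_meas : Measurable fun p : (Fin m → HierJackknife.Group 𝒳 𝒴) × 𝒳 => A p.1 p.2)
    (hA_symm : HierJackknife.HierSymmetric A)
    (D : Fin (m + 1) → Ω → HierJackknife.Group 𝒳 𝒴)
    (hD_law : ∀ k, HasLaw (D k) (HierJackknife.groupLaw PX PN PY) P)
    (hD_indep : iIndepFun D P)
    (α : ℝ) :
    Integrable
      (fun q : Ω × 𝒳 => HierJackknife.miscoverage PY α A (fun k => D k q.1) q.2 ^ 2)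
      (P.prod (HierJackknife.featureLawGeTwo PX PN)) ∧
    ∫ q : Ω × 𝒳, HierJackknife.miscoverage PY α A (fun k => D k q.1) q.2 ^ 2
      ∂(P.prod (HierJackknife.featureLawGeTwo PX PN)) ≤ 4 * α ^ 2 := by
  have hprob := HierJackknife.isProbabilityMeasure_featureLawGeTwo PX PN hN
  have hD : AEMeasurable (fun ω k => D k ω) P := aemeasurable_pi_lambda _ fun k =>
    (hD_law k).aemeasurable
  -- Independence makes the joint law of the data a product, so the integral over `Ω` becomes one
  -- over data sets.
  have hmap : P.map (fun ω k => D k ω) =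
      Measure.pi fun _ : Fin (m + 1) => HierJackknife.groupLaw PX PN PY := by
    rw [(iIndepFun_iff_map_fun_eq_pi_map fun k => (hD_law k).aemeasurable).1 hD_indep]
    simp only [(hD_law _).map_eq]
  have hM : Measurable fun p : (Fin (m + 1) → HierJackknife.Group 𝒳 𝒴) × 𝒳 =>
      HierJackknife.miscoverage PY α A p.1 p.2 ^ 2 :=
    (HierJackknife.measurable_miscoverage hA_meas PY α).pow_const 2
  have hae : AEMeasurable
      (fun q : Ω × 𝒳 => HierJackknife.miscoverage PY α A (fun k => D k q.1) q.2 ^ 2)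
      (P.prod (HierJackknife.featureLawGeTwo PX PN)) :=
    hM.comp_aemeasurable (f := fun q : Ω × 𝒳 => ((fun k => D k q.1), q.2))
      (hD.comp_fst.prodMk measurable_snd.aemeasurable)
  refine ⟨Integrable.of_bound hae.aestronglyMeasurable 1 (.of_forall fun q => ?_), ?_⟩
  · rw [Real.norm_of_nonneg (by positivity)]
    exact pow_le_one₀ measureReal_nonneg measureReal_le_one
  rw [integral_eq_lintegral_of_nonneg_ae (.of_forall fun q => sq_nonneg _)
    hae.aestronglyMeasurable]
  refine ENNReal.toReal_le_of_le_ofReal (by positivity) ?_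
  rw [lintegral_prod _ hae.ennreal_ofReal]
  have hH : Measurable fun d => ∫⁻ x, ENNReal.ofReal (HierJackknife.miscoverage PY α A d x ^ 2)
      ∂HierJackknife.featureLawGeTwo PX PN := hM.ennreal_ofReal.lintegral_prod_right'
  rw [← lintegral_map' (f := fun d => ∫⁻ x, ENNReal.ofReal
    (HierJackknife.miscoverage PY α A d x ^ 2) ∂HierJackknife.featureLawGeTwo PX PN)
    hH.aemeasurable hD, hmap]
  simp only [HierJackknife.ofReal_miscoverage_sq]
  exact HierJackknife.lintegral_kernel_uncovered_sq_le hA_meas PX PN PY hN α
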